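/- Let $\mathbb D\in\{\mathbb R,\mathbb C,\mathbb H\}$ with its usual conjugation, let $p,q\ge 0$ and $n=p+q$, let $J=\mathrm{diag}(\mathrm{Id}_p,-\mathrm{Id}_q)$, and for $n\times n$ matrices over $\mathbb D$ put $X^*=\overline X^{\,t}$, $X^\sharp=JX^*J$ and $X\bullet Y=XJY$. Let $\mathfrak p_J=\{X: X^\sharp=X\}$ and let $\mathscr P_J$ be the set of $X\in\mathfrak p_J$ such that $JX$ is (Hermitian) positive definite. The map $\exp_J(X)=J\exp(JX)$ is a bijection $\mathfrak p_J\to\mathscr P_J$; let $\log_J$ be its inverse, and for $X\in\mathscr P_J$, $t\in\mathbb R$ put $X_J^t=\exp_J(t\log_J X)$. For $A,B\in\mathscr P_J$ and $t\in[0,1]$ the weighted $J$-geometric mean is $$A\,\sharp^J_t\,B=A_J^{1/2}\bullet\bigl(A_J^{-1/2}\bullet B\bullet A_J^{-1/2}\bigr)_J^{t}\bullet A_J^{1/2}.$$ For $X,Y\in\mathscr P_J$ write $X\preceq_J Y$ if $JY-JX$ is Hermitian positive semidefinite. Let $K_J$ be the group of invertible matrices $g$ with $g^\sharp g=\mathrm{Id}_n$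 and $g^*g=\mathrm{Id}_n$. Proposition. (1) For all $g\in K_J$, $t\in[0,1]$ and $A,B\in\mathscr P_J$, $$(gAg^\sharp)\,\sharp^J_t\,(gBg^\sharp)=g\,(A\,\sharp^J_t\,B)\,g^\sharp .$$ (2) For all $A,B,C,D\in\mathscr P_J$ and $s,t\in[0,1]$, $$(1-s)\,(A\,\sharp^J_t\,C)+s\,(B\,\sharp^J_t\,D)\ \preceq_J\ \bigl((1-s)A+sB\bigr)\,\sharp^J_t\,\bigl((1-s)C+sD\bigr).$$ (3) For all $A,B\in\mathscr P_J$ and $s,t,u\in[0,1]$, $$(A\,\sharp^J_t\,B)\,\sharp^J_u\,(A\,\sharp^J_s\,B)=A\,\sharp^J_{(1-u)t+us}\,B .$$ (4) For all $A,B\in\mathscr P_J$ and $t\in[0,1]$, $$\bigl((1-t)A_J^{-1}+tB_J^{-1}\bigr)_J^{-1}\ \preceq_J\ A\,\sharp^J_t\,B\ \preceq_J\ (1-t)A+tB .$$ In (2) and (4), $X\preceq_J Y$ includes the assertion that both matrices lie in $\mathscr P_J$. -/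

import Mathlib

noncomputable section

namespace JMean

/-- `D`, with its norm, its real algebra structure and its conjugation, is `ℝ` (trivial
conjugation), `ℂ` (complex conjugation) or Hamilton's quaternions (quaternionic conjugation),
each with Mathlib's standard structures. -/
inductive IsRealComplexOrQuaternion :
    (D : Type) → [NormedDivisionRing D] → [NormedAlgebra ℝ D] → [StarRing D] → Prop
  | real : IsRealComplexOrQuaternion ℝ
  | complex : IsRealComplexOrQuaternion ℂ
  | quaternion : IsRealComplexOrQuaternion (Quaternion ℝ)

/-- `Mat(n)` with `n = p + q`, the rows and columns being indexed by the decomposition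
`Dⁿ = Dᵖ ⊕ D^q`. -/
abbrev Mat (D : Type) (p q : ℕ) : Type := Matrix (Fin p ⊕ Fin q) (Fin p ⊕ Fin q) D

section

variable {D : Type} [NormedDivisionRing D] [NormedAlgebra ℝ D] [StarRing D] {p q : ℕ}

/-- `J = diag(Id_p, -Id_q)`. -/
def J (D : Type) [NormedDivisionRing D] (p q : ℕ) : Mat D p q :=
  Matrix.fromBlocks 1 0 0 (-1)

/-- `X^♯ = J X^* J`. -/
def sharp (X : Mat D p q) : Mat D p q := J D p q * X.conjTranspose * J D p q

/-- The product `X • Y = X J Y`. -/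
def jmul (X Y : Mat D p q) : Mat D p q := X * J D p q * Y

/-- `⟨A u, u⟩ = (A u)^* u` is a positive real number for every nonzero vector `u`. -/
def IsPositive (A : Mat D p q) : Prop :=
  ∀ u : Fin p ⊕ Fin q → D, u ≠ 0 →
    ∃ r : ℝ, 0 < r ∧ star (A.mulVec u) ⬝ᵥ u = algebraMap ℝ D r

/-- `A` is Hermitian and `⟨A u, u⟩ = (A u)^* u` is a nonnegative real number for every
vector `u`. -/
def IsPosSemidef (A : Mat D p q) : Prop :=
  A.IsHermitian ∧ ∀ u : Fin p ⊕ Fin q → D,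
    ∃ r : ℝ, 0 ≤ r ∧ star (A.mulVec u) ⬝ᵥ u = algebraMap ℝ D r

/-- The real vector space of `J`-Hermitian matrices. -/
def hermJ (D : Type) [NormedDivisionRing D] [StarRing D] (p q : ℕ) : Set (Mat D p q) :=
  {X | sharp X = X}

/-- The cone of `J`-positive matrices. -/
def posJ (D : Type) [NormedDivisionRing D] [NormedAlgebra ℝ D] [StarRing D] (p q : ℕ) :
    Set (Mat D p q) :=
  {X | X ∈ hermJ D p q ∧ IsPositive (J D p q * X)}

/-- The group `U` of isometries of the standard positive form. -/
def unitaryGroup (D : Type) [NormedDivisionRing D] [StarRing D] (p q : ℕ) : Set (Mat D p q) :=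
  {g | IsUnit g ∧ g.conjTranspose * g = 1}

/-- The group `U_J` of isometries of the form with matrix `J`. -/
def unitaryGroupJ (D : Type) [NormedDivisionRing D] [StarRing D] (p q : ℕ) : Set (Mat D p q) :=
  {g | IsUnit g ∧ sharp g * g = 1}

/-- `K_J = U_J ∩ U`. -/
def compactK (D : Type) [NormedDivisionRing D] [StarRing D] (p q : ℕ) : Set (Mat D p q) :=
  unitaryGroupJ D p q ∩ unitaryGroup D p q

/-- The `J`-exponential `exp_J(X) = J exp(J X)`. -/
def expJ (X : Mat D p q) : Mat D p q := J D p q * NormedSpace.exp (J D p q * X)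

/-- The inverse `log_J` of the bijection `exp_J` from the `J`-Hermitian matrices onto the cone of
`J`-positive matrices. -/
def logJ (X : Mat D p q) : Mat D p q := Function.invFunOn expJ (hermJ D p q) X

/-- The `J`-power `X_J^t = exp_J(t log_J(X))`. -/
def powJ (X : Mat D p q) (t : ℝ) : Mat D p q := expJ (t • logJ X)

/-- The weighted `J`-geometric mean of `A` and `B`:
`A_J^{1/2} • (A_J^{-1/2} • B • A_J^{-1/2})_J^t • A_J^{1/2}`. -/
def meanJ (t : ℝ) (A B : Mat D p q) : Mat D p q :=
  jmul (jmul (powJ A (1 / 2))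
    (powJ (jmul (jmul (powJ A (-(1 / 2))) B) (powJ A (-(1 / 2)))) t)) (powJ A (1 / 2))

/-- The weighted `J`-harmonic mean: the `J`-inverse of `(1 - t) A_J^{-1} + t B_J^{-1}`. -/
def harmonicJ (t : ℝ) (A B : Mat D p q) : Mat D p q :=
  powJ ((1 - t) • powJ A (-1) + t • powJ B (-1)) (-1)

/-- The `J`-Loewner order on the cone of `J`-positive matrices: both matrices belong to the cone
and `J Y - J X` is Hermitian positive semidefinite. -/
def LeJ (X Y : Mat D p q) : Prop :=
  X ∈ posJ D p q ∧ Y ∈ posJ D p q ∧ IsPosSemidef (J D p q * Y - J D p q * X)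

end

end JMean

end

/-! The map X ↦ JX turns `jmul` into the ordinary product, J-Hermitian into Hermitian matrices and
`posJ` into the positive definite cone. It intertwines `expJ` with exp, hence `powJ` with real
powers and `meanJ` with the usual weighted geometric mean. An element g of K_J commutes with J, so X
↦ g X g^♯ becomes congruence by g. All four claims are thus claims about positive definite matrices
over D.

To treat ℝ, ℂ and ℍ together, these matrices are embedded by an injective star homomorphism φ into a
C⋆-algebra, where the claims hold for strictly positive elements. Functional calculus does not leave
the image of φ, by finite dimension, so equalities and order relations pull back.

In the C⋆-algebra, `geomMean_conj` gives (1); it reduces (3) to powers of one element. The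
inequalities (4) come from scalar AM-GM on a spectrum and from the antitonicity of inversion. Joint
concavity (2) is the operator Jensen inequality `conj_rpow_add_conj_rpow_le` for x ↦ x^t, itself
integrated from the Jensen inequality for the inverse. -/

namespace CFC

/-! ### Weighted geometric means in a C⋆-algebra -/

section

variable {A : Type*} [CStarAlgebra A] [PartialOrder A] [StarOrderedRing A]

/-- The weighted geometric mean `a ♯ₜ b` of two strictly positive elements of a C⋆-algebra. -/
noncomputable def geomMean (t : ℝ) (a b : A) : A :=
  a ^ (1 / 2 : ℝ) * (a ^ (-(1 / 2) : ℝ) * b * a ^ (-(1 / 2) : ℝ)) ^ t * a ^ (1 / 2 : ℝ)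

lemma star_rpow (a : A) (t : ℝ) : star (a ^ t) = a ^ t :=
  (IsSelfAdjoint.of_nonneg rpow_nonneg).star_eq

lemma _root_.IsStrictlyPositive.conj {a g : A} (ha : IsStrictlyPositive a) (hg : IsUnit g) :
    IsStrictlyPositive (g * a * star g) :=
  ((hg.mul ha.isUnit).mul hg.star).isStrictlyPositive (star_right_conjugate_nonneg ha.nonneg g)

lemma _root_.IsStrictlyPositive.conj_rpow {a b : A} (ha : IsStrictlyPositive a)
    (hb : IsStrictlyPositive b) (t : ℝ) : IsStrictlyPositive (a ^ t * b * a ^ t) := by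
  simpa only [star_rpow] using hb.conj (ha.rpow a t).isUnit

lemma rpow_half_mul_self {a : A} (ha : IsStrictlyPositive a) :
    a ^ (1 / 2 : ℝ) * a ^ (1 / 2 : ℝ) = a := by
  rw [← rpow_add ha.isUnit, add_halves, rpow_one a]

lemma rpow_half_mul_rpow_neg_half {a : A} (ha : IsStrictlyPositive a) :
    a ^ (1 / 2 : ℝ) * a ^ (-(1 / 2) : ℝ) = 1 :=
  rpow_mul_rpow_neg _

lemma rpow_neg_half_mul_rpow_half {a : A} (ha : IsStrictlyPositive a) :
    a ^ (-(1 / 2) : ℝ) * a ^ (1 / 2 : ℝ) = 1 :=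
  rpow_neg_mul_rpow _

lemma rpow_half_conj_neg_half {a : A} (ha : IsStrictlyPositive a) (b : A) :
    a ^ (1 / 2 : ℝ) * (a ^ (-(1 / 2) : ℝ) * b * a ^ (-(1 / 2) : ℝ)) * a ^ (1 / 2 : ℝ) = b := by
  calc _ = (a ^ (1 / 2 : ℝ) * a ^ (-(1 / 2) : ℝ)) * b *
        (a ^ (-(1 / 2) : ℝ) * a ^ (1 / 2 : ℝ)) := by simp only [mul_assoc]
    _ = b := by rw [rpow_half_mul_rpow_neg_half ha, rpow_neg_half_mul_rpow_half ha]; simp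

lemma rpow_neg_half_conj_half {a : A} (ha : IsStrictlyPositive a) (b : A) :
    a ^ (-(1 / 2) : ℝ) * (a ^ (1 / 2 : ℝ) * b * a ^ (1 / 2 : ℝ)) * a ^ (-(1 / 2) : ℝ) = b := by
  calc _ = (a ^ (-(1 / 2) : ℝ) * a ^ (1 / 2 : ℝ)) * b *
        (a ^ (1 / 2 : ℝ) * a ^ (-(1 / 2) : ℝ)) := by simp only [mul_assoc]
    _ = b := by rw [rpow_half_mul_rpow_neg_half ha, rpow_neg_half_mul_rpow_half ha]; simp

lemma _root_.IsStrictlyPositive.geomMean {a b : A} (ha : IsStrictlyPositive a)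
    (hb : IsStrictlyPositive b) (t : ℝ) : IsStrictlyPositive (geomMean t a b) :=
  ha.conj_rpow ((ha.conj_rpow hb _).rpow _ t) _

/-- Unitary conjugation is a star automorphism, so it commutes with functional calculus.
Invertibility keeps 0 out of the spectrum, which makes x ↦ x^t continuous there for negative t as
well. -/
lemma unitary_conj_rpow {a u : A} (ha : 0 ≤ a) (hu : star u * u = 1) (hu' : u * star u = 1)
    (ha' : IsUnit a) (t : ℝ) : (u * a * star u) ^ t = u * a ^ t * star u := by
  let U : unitary A := ⟨u, Unitary.mem_iff.mpr ⟨hu, hu'⟩⟩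
  have h0 : 0 ≤ u * a * star u := star_right_conjugate_nonneg ha u
  have hs : ContinuousOn (fun x : ℝ ↦ x ^ t) (spectrum ℝ a) :=
    ContinuousOn.rpow_const (by fun_prop) fun x hx ↦
      .inl fun h ↦ spectrum.zero_notMem ℝ ha' (h ▸ hx)
  have := StarAlgHomClass.map_cfc (S := ℂ) (Unitary.conjStarAlgAut ℂ A U) (fun x : ℝ ↦ x ^ t) a hs
    (by
      have : ⇑(Unitary.conjStarAlgAut ℂ A U) = fun x ↦ u * x * star u := by
        ext x; exact Unitary.conjStarAlgAut_apply U x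
      rw [this]; fun_prop) (IsSelfAdjoint.of_nonneg ha)
    (by rw [Unitary.conjStarAlgAut_apply]; exact IsSelfAdjoint.of_nonneg h0)
  rw [Unitary.conjStarAlgAut_apply, Unitary.conjStarAlgAut_apply] at this
  rw [rpow_eq_cfc_real (a := a), rpow_eq_cfc_real (a := u * a * star u)]
  exact this.symm

/-- The weighted geometric mean is equivariant under congruences. -/
theorem geomMean_conj {a b g : A} (ha : IsStrictlyPositive a) (hb : IsStrictlyPositive b)
    (hg : IsUnit g) (t : ℝ) :
    geomMean t (g * a * star g) (g * b * star g) = g * geomMean t a b * star g := by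
  have ha' := ha.conj hg
  set a' := g * a * star g with ha'_def
  set h := a ^ (1 / 2 : ℝ) with hh
  set k := a ^ (-(1 / 2) : ℝ) with hk
  set h' := a' ^ (1 / 2 : ℝ) with hh'
  set k' := a' ^ (-(1 / 2) : ℝ) with hk'
  have sh : star h = h := star_rpow _ _
  have sk' : star k' = k' := star_rpow _ _
  have hku : h' * k' = 1 := rpow_half_mul_rpow_neg_half ha'
  have hku' : k' * h' = 1 := rpow_neg_half_mul_rpow_half ha'
  -- This u = a'^(-1/2) g a^(1/2) is unitary, because g a g⋆ = a'. It conjugates the inner factor of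
  -- one mean into that of the other.
  set u := k' * g * h with hu
  have su : star u = h * star g * k' := by simp [hu, sh, sk', mul_assoc]
  have h1 : u * star u = 1 := by
    calc u * star u = k' * (g * (h * h) * star g) * k' := by rw [su, hu]; simp only [mul_assoc]
      _ = k' * a' * k' := by rw [rpow_half_mul_self ha]
      _ = 1 := conjugate_rpow_neg_one_half a'
  have uu : IsUnit u :=
    ((ha'.rpow a' _).isUnit.mul hg).mul (ha.rpow a _).isUnit
  have h2 : star u * u = 1 := by
    obtain ⟨v, hv⟩ := uu
    rw [← hv] at h1 ⊢
    have : star (v : A) = ↑v⁻¹ := by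
      rw [← Units.inv_mul_cancel_left v (star (v : A)), h1, mul_one]
    rw [this, Units.inv_mul]
  have hc : IsStrictlyPositive (k * b * k) := ha.conj_rpow hb _
  have h3 : k' * (g * b * star g) * k' = u * (k * b * k) * star u := by
    rw [su, hu]
    calc _ = k' * g * (h * (k * b * k) * h) * star g * k' := by
          rw [rpow_half_conj_neg_half ha]; simp only [mul_assoc]
      _ = _ := by simp only [mul_assoc]
  rw [geomMean, geomMean, ← hh', ← hk', ← hh, ← hk, h3, unitary_conj_rpow hc.nonneg h2 h1 hc.isUnit,
    su, hu]
  calc _ = (h' * k') * (g * h * (k * b * k) ^ t * (h * star g)) * (k' * h') := by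
        simp only [mul_assoc]
    _ = _ := by rw [hku, hku']; simp only [mul_assoc, one_mul, mul_one]

lemma rpow_rpow' {c : A} (hc : IsStrictlyPositive c) (x y : ℝ) : (c ^ x) ^ y = c ^ (x * y) := by
  rcases eq_or_ne x 0 with rfl | hx
  · simp [rpow_zero c hc.nonneg]
  · exact rpow_rpow c x y hx

lemma geomMean_rpow_rpow {c : A} (hc : IsStrictlyPositive c) (s t u : ℝ) :
    geomMean u (c ^ t) (c ^ s) = c ^ ((1 - u) * t + u * s) := by
  simp only [geomMean, rpow_rpow' hc, ← rpow_add hc.isUnit]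
  congr 1
  ring

/-- The weighted geometric means interpolate each other. -/
theorem geomMean_geomMean {a b : A} (ha : IsStrictlyPositive a) (hb : IsStrictlyPositive b)
    (s t u : ℝ) :
    geomMean u (geomMean t a b) (geomMean s a b) = geomMean ((1 - u) * t + u * s) a b := by
  have hc := ha.conj_rpow hb (-(1 / 2))
  -- With c = a^(-1/2) b a^(-1/2), each mean of a and b is by definition a power of c under
  -- congruence by a^(1/2).
  have := geomMean_conj (hc.rpow _ t) (hc.rpow _ s) (ha.rpow a (1 / 2)).isUnit u
  rw [star_rpow, geomMean_rpow_rpow hc] at this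
  exact this

lemma rpow_le_one_sub_add_smul {c : A} (hc : IsStrictlyPositive c) {t : ℝ}
    (ht : t ∈ Set.Icc (0 : ℝ) 1) : c ^ t ≤ (1 - t) • (1 : A) + t • c := by
  have h0 : ∀ x ∈ spectrum ℝ c, 0 < x := fun x hx ↦ hc.spectrum_pos hx
  have hcont : ContinuousOn (fun x : ℝ ↦ x ^ t) (spectrum ℝ c) :=
    ContinuousOn.rpow_const (by fun_prop) fun x hx ↦ .inl (h0 x hx).ne'
  have h1 : (1 - t) • (1 : A) + t • c = cfc (fun x : ℝ ↦ (1 - t) + t * x) c := by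
    rw [cfc_const_add (1 - t) (fun x ↦ t * x) c, cfc_const_mul t (fun x ↦ x) c, cfc_id' ℝ c,
      Algebra.algebraMap_eq_smul_one]
  rw [h1, rpow_eq_cfc_real]
  refine cfc_mono fun x hx ↦ ?_
  have := Real.geom_mean_le_arith_mean2_weighted (sub_nonneg.2 ht.2) ht.1 zero_le_one (h0 x hx).le
    (by ring)
  simpa using this

lemma conj_le_conj_of_star_eq {x y h : A} (hxy : x ≤ y) (hh : star h = h) :
    h * x * h ≤ h * y * h := by
  simpa only [hh] using star_right_conjugate_le_conjugate hxy h

/-- The weighted arithmetic-geometric mean inequality. -/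
theorem geomMean_le_arith {a b : A} (ha : IsStrictlyPositive a) (hb : IsStrictlyPositive b) {t : ℝ}
    (ht : t ∈ Set.Icc (0 : ℝ) 1) : geomMean t a b ≤ (1 - t) • a + t • b := by
  have hc := ha.conj_rpow hb (-(1 / 2))
  refine (conj_le_conj_of_star_eq (rpow_le_one_sub_add_smul hc ht) (star_rpow a _)).trans_eq ?_
  rw [mul_add, add_mul, mul_smul_comm, smul_mul_assoc, mul_one, rpow_half_mul_self ha,
    mul_smul_comm, smul_mul_assoc, rpow_half_conj_neg_half ha]

lemma rpow_neg_one_eq_of_mul_eq_one {x y : A} (hx : IsStrictlyPositive x) (h : x * y = 1) :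
    x ^ (-1 : ℝ) = y := by
  have h1 : x ^ (-1 : ℝ) * x = 1 := by
    simpa [rpow_one x] using rpow_neg_mul_rpow 1 hx
  rw [← mul_one (x ^ (-1 : ℝ)), ← h, ← mul_assoc, h1, one_mul]

lemma mul_rpow_neg_one {x : A} (hx : IsStrictlyPositive x) : x * x ^ (-1 : ℝ) = 1 := by
  simpa [rpow_one x] using rpow_mul_rpow_neg 1 hx

/-- The weighted geometric-harmonic mean inequality. -/
theorem harm_le_geomMean {a b : A} (ha : IsStrictlyPositive a) (hb : IsStrictlyPositive b) {t : ℝ}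
    (ht : t ∈ Set.Icc (0 : ℝ) 1) :
    ((1 - t) • a ^ (-1 : ℝ) + t • b ^ (-1 : ℝ)) ^ (-1 : ℝ) ≤ geomMean t a b := by
  set h := a ^ (1 / 2 : ℝ) with hh
  set k := a ^ (-(1 / 2) : ℝ) with hk
  have hkk : h * k = 1 := rpow_half_mul_rpow_neg_half ha
  have hkk' : k * h = 1 := rpow_neg_half_mul_rpow_half ha
  have hc : IsStrictlyPositive (k * b * k) := ha.conj_rpow hb _
  set c := k * b * k with hcdef
  have hci := hc.rpow c (-1)
  have h1 : c ^ (-1 : ℝ) = h * b ^ (-1 : ℝ) * h := by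
    refine rpow_neg_one_eq_of_mul_eq_one hc ?_
    calc _ = k * b * (k * h) * b ^ (-1 : ℝ) * h := by simp only [hcdef, mul_assoc]
      _ = k * (b * b ^ (-1 : ℝ)) * h := by rw [hkk']; simp only [mul_assoc, one_mul]
      _ = 1 := by rw [mul_rpow_neg_one hb, mul_one, hkk']
  -- AM-GM for c⁻¹, conjugated by a^(-1/2). The left side is the inverse of the geometric mean, so
  -- inverting both sides finishes.
  have h2 : k * c ^ (-t) * k ≤ (1 - t) • a ^ (-1 : ℝ) + t • b ^ (-1 : ℝ) := by
    have := rpow_le_one_sub_add_smul hci ht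
    rw [rpow_rpow' hc, neg_one_mul] at this
    refine (conj_le_conj_of_star_eq this (star_rpow a _)).trans_eq ?_
    rw [mul_add, add_mul, mul_smul_comm, smul_mul_assoc, mul_one, mul_smul_comm, smul_mul_assoc,
      h1, rpow_neg_half_conj_half ha, ← rpow_add ha.isUnit]
    norm_num
  have hp : IsStrictlyPositive (k * c ^ (-t) * k) := ha.conj_rpow (hc.rpow c _) _
  refine (CStarAlgebra.rpow_neg_one_le_rpow_neg_one h2 hp).trans_eq ?_
  refine rpow_neg_one_eq_of_mul_eq_one hp ?_
  calc _ = k * c ^ (-t) * (k * h) * c ^ t * h := by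
        rw [geomMean]; simp only [mul_assoc, hcdef, hh, hk]
    _ = k * (c ^ (-t) * c ^ t) * h := by rw [hkk']; simp only [mul_assoc, one_mul]
    _ = 1 := by rw [rpow_neg_mul_rpow t hc, mul_one, hkk']

end

end CFC

/-! ### Operator Jensen inequality and joint concavity -/

namespace CFC

section

variable {A : Type*} [CStarAlgebra A] [PartialOrder A] [StarOrderedRing A]

/-- Completing the square: with z = y⁻¹ the difference of the two sides is (zx - v)⋆ y (zx - v). -/
lemma conj_inverse_le {y z x v : A} (hy : 0 ≤ y) (hz : z * y = 1) (hz' : y * z = 1)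
    (hzs : star z = z) :
    star x * v + star v * x - star v * y * v ≤ star x * z * x := by
  have h : 0 ≤ star (z * x - v) * y * (z * x - v) := star_left_conjugate_nonneg hy _
  have e : star (z * x - v) * y * (z * x - v) =
      star x * z * x - (star x * v + star v * x - star v * y * v) := by
    rw [star_sub, star_mul, hzs]
    calc _ = star x * (z * y) * z * x - star x * (z * y) * v - star v * (y * z) * x
          + star v * y * v := by noncomm_ring
      _ = _ := by rw [hz, hz']; noncomm_ring
  rw [e] at h
  exact sub_nonneg.1 h

/-- The operator Jensen inequality for the inverse. -/
lemma ringInverse_conj_add_conj_le {y₁ y₂ x₁ x₂ w : A} (h₁ : IsStrictlyPositive y₁)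
    (h₂ : IsStrictlyPositive y₂) (hw : w = star x₁ * y₁ * x₁ + star x₂ * y₂ * x₂)
    (hx : star x₁ * x₁ + star x₂ * x₂ = 1) (hwp : IsStrictlyPositive w) :
    Ring.inverse w ≤ star x₁ * Ring.inverse y₁ * x₁ + star x₂ * Ring.inverse y₂ * x₂ := by
  have sw := hwp.ringInverse.isSelfAdjoint.star_eq
  -- With v_i = x_i w⁻¹ the two lower bounds add up to 2w⁻¹ - w⁻¹ w w⁻¹ = w⁻¹.
  refine le_trans (le_of_eq ?_) (add_le_add
    (conj_inverse_le (v := x₁ * Ring.inverse w) h₁.nonneg (Ring.inverse_mul_cancel _ h₁.isUnit)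
      (Ring.mul_inverse_cancel _ h₁.isUnit) h₁.ringInverse.isSelfAdjoint.star_eq)
    (conj_inverse_le (v := x₂ * Ring.inverse w) h₂.nonneg (Ring.inverse_mul_cancel _ h₂.isUnit)
      (Ring.mul_inverse_cancel _ h₂.isUnit) h₂.ringInverse.isSelfAdjoint.star_eq))
  simp only [star_mul, sw]
  set z := Ring.inverse w
  have hz : z * w = 1 := Ring.inverse_mul_cancel _ hwp.isUnit
  symm
  calc _ = (star x₁ * x₁ + star x₂ * x₂) * z + z * (star x₁ * x₁ + star x₂ * x₂)
        - z * (star x₁ * y₁ * x₁ + star x₂ * y₂ * x₂) * z := by noncomm_ring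
    _ = z := by rw [← hw, hx, hz]; noncomm_ring

open Real in
lemma cfc_rpowIntegrand₀₁_eq_ringInverse {p t : ℝ} (hp : p ∈ Set.Ioo 0 1) (ht : 0 < t) {x : A}
    (hx : 0 ≤ x) : cfc (rpowIntegrand₀₁ p t) x =
      algebraMap ℝ A (t ^ (p - 1)) - t ^ p • Ring.inverse (algebraMap ℝ A t + x) := by
  rw [rpowIntegrand₀₁_eq_sub (by grind) ht]
  have hg : ContinuousOn (fun z : ℝ => (t + z)⁻¹) (spectrum ℝ x) := by
    fun_prop (disch := grind -abstractProof)
  have hspectrum : ∀ r ∈ spectrum ℝ x, t + r ≠ 0 := by grind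
  have hx' := IsSelfAdjoint.of_nonneg hx
  rw [cfc_sub (fun _ : ℝ => t ^ (p - 1)) (fun z : ℝ => t ^ p * (t + z)⁻¹) x continuousOn_const
    (continuousOn_const.mul hg), cfc_const _ _ hx', cfc_const_mul (t ^ p) _ x hg,
    cfc_inv _ _ hspectrum (by fun_prop) hx', cfc_const_add t (fun z ↦ z) x continuousOn_id hx',
    cfc_id' ℝ x hx']

open Real in
-- The integrand is a constant minus a positive multiple of (t + x)⁻¹. Since the x_i⋆ x_i sum to 1,
-- the shift by t passes through the Jensen combination and the inequality for the inverse applies.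
lemma conj_cfc_rpowIntegrand₀₁_le {p t : ℝ} (hp : p ∈ Set.Ioo 0 1) (ht : 0 < t) {a₁ a₂ x₁ x₂ : A}
    (h₁ : 0 ≤ a₁) (h₂ : 0 ≤ a₂) (hx : star x₁ * x₁ + star x₂ * x₂ = 1) :
    star x₁ * cfc (rpowIntegrand₀₁ p t) a₁ * x₁ + star x₂ * cfc (rpowIntegrand₀₁ p t) a₂ * x₂ ≤
      cfc (rpowIntegrand₀₁ p t) (star x₁ * a₁ * x₁ + star x₂ * a₂ * x₂) := by
  have h0 : 0 ≤ star x₁ * a₁ * x₁ + star x₂ * a₂ * x₂ :=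
    add_nonneg (star_left_conjugate_nonneg h₁ _) (star_left_conjugate_nonneg h₂ _)
  have htp : IsStrictlyPositive (algebraMap ℝ A t) :=
    ((isUnit_iff_ne_zero.2 ht.ne').map (algebraMap ℝ A)).isStrictlyPositive
      (algebraMap_nonneg A ht.le)
  rw [cfc_rpowIntegrand₀₁_eq_ringInverse hp ht h₁, cfc_rpowIntegrand₀₁_eq_ringInverse hp ht h₂,
    cfc_rpowIntegrand₀₁_eq_ringInverse hp ht h0]
  have hw : algebraMap ℝ A t + (star x₁ * a₁ * x₁ + star x₂ * a₂ * x₂) =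
      star x₁ * (algebraMap ℝ A t + a₁) * x₁ + star x₂ * (algebraMap ℝ A t + a₂) * x₂ := by
    have : algebraMap ℝ A t = t • (star x₁ * x₁ + star x₂ * x₂) := by
      rw [hx, Algebra.algebraMap_eq_smul_one]
    nth_rw 1 [this]
    simp only [Algebra.algebraMap_eq_smul_one, mul_add, add_mul, mul_smul_comm, smul_mul_assoc,
      mul_one, smul_add]
    abel
  have key := ringInverse_conj_add_conj_le (htp.add_nonneg h₁) (htp.add_nonneg h₂) hw hx
    (htp.add_nonneg h0)
  have e : ∀ c : ℝ, algebraMap ℝ A c = c • (star x₁ * x₁) + c • (star x₂ * x₂) := fun c ↦ by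
    rw [← smul_add, hx, Algebra.algebraMap_eq_smul_one]
  have key' := smul_le_smul_of_nonneg_left key (Real.rpow_nonneg ht.le p)
  rw [e (t ^ (p - 1))]
  calc _ = t ^ (p - 1) • (star x₁ * x₁) + t ^ (p - 1) • (star x₂ * x₂) -
        t ^ p • (star x₁ * Ring.inverse (algebraMap ℝ A t + a₁) * x₁ +
          star x₂ * Ring.inverse (algebraMap ℝ A t + a₂) * x₂) := by
        rw [← e, mul_sub, mul_sub, sub_mul, sub_mul, Algebra.algebraMap_eq_smul_one]
        simp only [mul_smul_comm, smul_mul_assoc, mul_one, smul_add]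
        rw [← hx, smul_add]
        abel
    _ ≤ _ := sub_le_sub_left key' _

open Real MeasureTheory in
/-- The operator Jensen inequality for the power functions with exponent in `[0, 1]`. -/
theorem conj_rpow_add_conj_rpow_le {p : ℝ} (hp : p ∈ Set.Icc (0 : ℝ) 1) {a₁ a₂ x₁ x₂ : A}
    (h₁ : 0 ≤ a₁) (h₂ : 0 ≤ a₂) (hx : star x₁ * x₁ + star x₂ * x₂ = 1) :
    star x₁ * a₁ ^ p * x₁ + star x₂ * a₂ ^ p * x₂ ≤
      (star x₁ * a₁ * x₁ + star x₂ * a₂ * x₂) ^ p := by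
  have h0 : 0 ≤ star x₁ * a₁ * x₁ + star x₂ * a₂ * x₂ :=
    add_nonneg (star_left_conjugate_nonneg h₁ _) (star_left_conjugate_nonneg h₂ _)
  -- The integral representation needs 0 < p < 1; at both endpoints equality holds.
  rcases hp.1.eq_or_lt with rfl | hp0
  · rw [rpow_zero a₁, rpow_zero a₂, rpow_zero _ h0, mul_one, mul_one, hx]
  rcases hp.2.eq_or_lt with rfl | hp1
  · rw [rpow_one a₁, rpow_one a₂, rpow_one _ h0]
  lift p to NNReal using hp.1
  have hp' : p ∈ Set.Ioo (0 : NNReal) 1 := ⟨by exact_mod_cast hp0, by exact_mod_cast hp1⟩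
  obtain ⟨μ, hμ⟩ := exists_measure_nnrpow_eq_integral_cfcₙ_rpowIntegrand₀₁ A hp'
  simp only [← nnrpow_eq_rpow hp'.1]
  rw [(hμ a₁ h₁).2, (hμ a₂ h₂).2, (hμ _ h0).2]
  let Φ (x : A) : A →L[ℝ] A :=
    (ContinuousLinearMap.mul ℝ A (star x)).comp ((ContinuousLinearMap.mul ℝ A).flip x)
  have hΦ (x a : A) : Φ x a = star x * a * x := by simp [Φ, mul_assoc]
  have i₁ := (Φ x₁).integrable_comp (hμ a₁ h₁).1
  have i₂ := (Φ x₂).integrable_comp (hμ a₂ h₂).1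
  rw [← hΦ, ← hΦ, ← (Φ x₁).integral_comp_comm (hμ a₁ h₁).1,
    ← (Φ x₂).integral_comp_comm (hμ a₂ h₂).1, ← integral_add i₁ i₂]
  refine integral_mono_ae (i₁.add i₂) (hμ _ h0).1 ?_
  filter_upwards [ae_restrict_mem measurableSet_Ioi] with t ht
  have hc (a : A) (ha : 0 ≤ a) :
      cfcₙ (rpowIntegrand₀₁ p t) a = cfc (rpowIntegrand₀₁ p t) a :=
    cfcₙ_eq_cfc ((continuousOn_rpowIntegrand₀₁_Ici (by exact_mod_cast hp') ht).mono (by grind))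
      (by simp)
  rw [hΦ, hΦ, hc _ h₁, hc _ h₂, hc _ h0]
  exact conj_cfc_rpowIntegrand₀₁_le (by exact_mod_cast hp') ht h₁ h₂ hx

lemma _root_.IsStrictlyPositive.convexCombo {a b : A} (ha : IsStrictlyPositive a)
    (hb : IsStrictlyPositive b) {s : ℝ} (hs : s ∈ Set.Icc (0 : ℝ) 1) :
    IsStrictlyPositive ((1 - s) • a + s • b) := by
  rcases hs.1.eq_or_lt with rfl | h0
  · simpa using ha
  · exact IsStrictlyPositive.nonneg_add (smul_nonneg (sub_nonneg.2 hs.2) ha.nonneg) (hb.smul h0)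

/-- The weighted geometric means are jointly concave. -/
theorem geomMean_jointly_concave {a b c e : A} (ha : IsStrictlyPositive a)
    (hb : IsStrictlyPositive b) (hc : IsStrictlyPositive c) (he : IsStrictlyPositive e) {t s : ℝ}
    (ht : t ∈ Set.Icc (0 : ℝ) 1) (hs : s ∈ Set.Icc (0 : ℝ) 1) :
    (1 - s) • geomMean t a c + s • geomMean t b e ≤
      geomMean t ((1 - s) • a + s • b) ((1 - s) • c + s • e) := by
  have hm := IsStrictlyPositive.convexCombo ha hb hs
  set m := (1 - s) • a + s • b with hmdef
  set k := m ^ (-(1 / 2) : ℝ) with hk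
  have sk : star k = k := star_rpow _ _
  have r1 : √(1 - s) * √(1 - s) = 1 - s := Real.mul_self_sqrt (sub_nonneg.2 hs.2)
  have r2 : √s * √s = s := Real.mul_self_sqrt hs.1
  have conj_eq (r : ℝ) (x y : A) : star (r • (x ^ (1 / 2 : ℝ) * k)) * y * (r • (x ^ (1 / 2 : ℝ) * k))
      = (r * r) • (k * (x ^ (1 / 2 : ℝ) * y * x ^ (1 / 2 : ℝ)) * k) := by
    rw [star_smul, star_mul, sk, star_rpow, star_trivial]
    simp only [mul_smul_comm, smul_mul_assoc, smul_smul, mul_assoc]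
  -- With x₁ = √(1-s) a^(1/2) m^(-1/2) and x₂ = √s b^(1/2) m^(-1/2), the sum of the x_i⋆ x_i is
  -- m^(-1/2) m m^(-1/2) = 1. Jensen is then applied to the inner factors of the two means and
  -- conjugated by m^(1/2).
  have hx : star (√(1 - s) • (a ^ (1 / 2 : ℝ) * k)) * (√(1 - s) • (a ^ (1 / 2 : ℝ) * k)) +
      star (√s • (b ^ (1 / 2 : ℝ) * k)) * (√s • (b ^ (1 / 2 : ℝ) * k)) = 1 := by
    have e1 := conj_eq (√(1 - s)) a 1
    have e2 := conj_eq (√s) b 1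
    rw [mul_one, mul_one, rpow_half_mul_self ha, r1] at e1
    rw [mul_one, mul_one, rpow_half_mul_self hb, r2] at e2
    have e3 : k * m * k = 1 := conjugate_rpow_neg_one_half m hm
    rw [e1, e2, ← e3, hmdef]
    simp only [mul_add, add_mul, mul_smul_comm, smul_mul_assoc]
  have key := conj_rpow_add_conj_rpow_le ht (ha.conj_rpow hc (-(1 / 2))).nonneg
    (hb.conj_rpow he (-(1 / 2))).nonneg hx
  simp only [conj_eq, r1, r2, rpow_half_conj_neg_half ha, rpow_half_conj_neg_half hb] at key
  have := conj_le_conj_of_star_eq key (star_rpow m (1 / 2))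
  refine le_trans (le_of_eq ?_) (this.trans_eq ?_)
  · simp only [mul_add, add_mul, mul_smul_comm, smul_mul_assoc]
    rw [hk, rpow_half_conj_neg_half hm, rpow_half_conj_neg_half hm]
    rfl
  · rw [geomMean]
    simp only [mul_add, add_mul, mul_smul_comm, smul_mul_assoc, hk]

end

end CFC

/-! ### Functional calculus inside finite-dimensional subalgebras -/

section

variable {R A : Type*} [Ring R] [Algebra ℝ R] [FiniteDimensional ℝ R]

lemma spectrum.finite_of_finiteDimensional (X : R) : (spectrum ℝ X).Finite := by
  refine ((minpoly ℝ X).rootSet_finite ℝ).subset fun x hx ↦ ?_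
  have hx' := spectrum.subset_polynomial_aeval X (minpoly ℝ X) (Set.mem_image_of_mem _ hx)
  rw [minpoly.aeval] at hx'
  rw [Polynomial.mem_rootSet]
  refine ⟨minpoly.ne_zero (Algebra.IsIntegral.isIntegral X), ?_⟩
  by_contra h
  rw [spectrum.mem_iff, sub_zero] at hx'
  exact hx' ((isUnit_iff_ne_zero.2 h).map (algebraMap ℝ R))

/-- The functional calculus of a selfadjoint element of a finite-dimensional subalgebra stays in
this subalgebra. -/
lemma StarAlgHom.exists_map_eq_cfc [StarRing R] [CStarAlgebra A] (φ : R →⋆ₐ[ℝ] A)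
    {X : R} (hX : IsSelfAdjoint (φ X))
    (f : ℝ → ℝ) : ∃ Y, φ Y = cfc f (φ X) := by
  have hfin : (spectrum ℝ (φ X)).Finite :=
    (spectrum.finite_of_finiteDimensional X).subset (AlgHom.spectrum_apply_subset φ X)
  -- On the finite spectrum f agrees with a polynomial, and polynomials in φ X lie in the image of
  -- φ.
  let P := Lagrange.interpolate hfin.toFinset id f
  refine ⟨Polynomial.aeval X P, ?_⟩
  have h : cfc f (φ X) = cfc P.eval (φ X) := cfc_congr fun x hx ↦
    (Lagrange.eval_interpolate_at_node (v := id) f Function.injective_id.injOn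
      (hfin.mem_toFinset.2 hx)).symm
  rw [h, cfc_polynomial P (φ X) hX]
  exact (Polynomial.aeval_algHom_apply φ X P).symm

end

section

variable {A : Type*} [CStarAlgebra A] [PartialOrder A] [StarOrderedRing A]

lemma CFC.exp_smul_log {a : A} (ha : IsStrictlyPositive a) (t : ℝ) :
    NormedSpace.exp (t • log a) = a ^ t := by
  have h0 : ∀ x ∈ spectrum ℝ a, 0 < x := fun x hx ↦ ha.spectrum_pos hx
  have hlog : ContinuousOn Real.log (spectrum ℝ a) :=
    Real.continuousOn_log.mono fun x hx ↦ (h0 x hx).ne'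
  have hsa : IsSelfAdjoint (t • log a) := IsSelfAdjoint.smul (.all t) .log
  rw [← real_exp_eq_normedSpace_exp hsa, log, ← cfc_const_mul t _ a hlog,
    ← cfc_comp' Real.exp (fun x ↦ t * Real.log x) a (by fun_prop) (by fun_prop) ha.isSelfAdjoint,
    rpow_eq_cfc_real ha.nonneg]
  refine cfc_congr fun x hx ↦ ?_
  simp only [Real.rpow_def_of_pos (h0 x hx), mul_comm]

end

/-! ### Embedding matrices over ℝ, ℂ and ℍ into C⋆-algebras -/

section

variable {n D E : Type*} [Fintype n] [DecidableEq n]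

/-- The entrywise extension of a real star algebra homomorphism to matrices. -/
noncomputable def CStarMatrix.mapStarAlgHom [Ring D] [StarRing D] [Algebra ℝ D] [CStarAlgebra E]
    (f : D →⋆ₐ[ℝ] E) : Matrix n n D →⋆ₐ[ℝ] CStarMatrix n n E where
  toFun M := CStarMatrix.ofMatrix (M.map f)
  map_one' := by ext i j; simp [Matrix.one_apply, CStarMatrix.one_apply]
  map_mul' M N := by ext i j; simp [Matrix.mul_apply, CStarMatrix.mul_apply]
  map_zero' := by ext i j; simp
  map_add' M N := by ext i j; simp
  commutes' r := by
    ext i j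
    by_cases h : i = j <;>
      simp [Matrix.algebraMap_matrix_apply, CStarMatrix.algebraMap_apply, h]
    exact AlgHomClass.commutes f r
  map_star' M := by ext i j; simp [Matrix.star_apply, CStarMatrix.star_apply, map_star]

lemma CStarMatrix.mapStarAlgHom_injective [Ring D] [StarRing D] [Algebra ℝ D] [CStarAlgebra E]
    {f : D →⋆ₐ[ℝ] E} (hf : Function.Injective f) :
    Function.Injective (CStarMatrix.mapStarAlgHom (n := n) f) := fun M N h ↦ by
  ext i j
  exact hf (congrFun (congrFun h i) j)

/-- The standard embedding of the quaternions into the complex `2 × 2` matrices. -/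
noncomputable def Quaternion.toCStarMatrix :
    Quaternion ℝ →⋆ₐ[ℝ] CStarMatrix (Fin 2) (Fin 2) ℂ where
  -- Writing x = z + w j with z, w complex, the rows are (z, w) and (-w̄, z̄).
  toFun x := CStarMatrix.ofMatrix !![⟨x.re, x.imI⟩, ⟨x.imJ, x.imK⟩; ⟨-x.imJ, x.imK⟩, ⟨x.re, -x.imI⟩]
  map_one' := by
    ext i j; fin_cases i <;> fin_cases j <;> simp [Complex.ext_iff]
  map_mul' M N := by
    ext i j
    fin_cases i <;> fin_cases j <;>
      simp [Complex.ext_iff, CStarMatrix.mul_apply, Fin.sum_univ_two] <;>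
      constructor <;> ring
  map_zero' := by ext i j; fin_cases i <;> fin_cases j <;> simp [Complex.ext_iff]
  map_add' M N := by
    ext i j; fin_cases i <;> fin_cases j <;> simp [Complex.ext_iff, add_comm]
  commutes' r := by
    ext i j; fin_cases i <;> fin_cases j <;> simp [Complex.ext_iff, CStarMatrix.algebraMap_apply]
  map_star' M := by
    ext i j; fin_cases i <;> fin_cases j <;> simp [Complex.ext_iff, CStarMatrix.star_apply]

lemma Quaternion.toCStarMatrix_injective : Function.Injective Quaternion.toCStarMatrix := by
  intro x y h
  have h0 := Complex.ext_iff.1 (congrFun (congrFun h 0) 0)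
  have h1 := Complex.ext_iff.1 (congrFun (congrFun h 0) 1)
  exact QuaternionAlgebra.ext h0.1 h0.2 h1.1 h1.2

end

namespace JMean

open scoped ComplexOrder in
lemma IsRealComplexOrQuaternion.exists_embedding {D : Type} [NormedDivisionRing D]
    [NormedAlgebra ℝ D] [StarRing D] (hD : IsRealComplexOrQuaternion D) :
    FiniteDimensional ℝ D ∧ StarModule ℝ D ∧
      (∀ x : D, star x * x = algebraMap ℝ D (‖x‖ ^ 2)) ∧
      ∃ (E : Type) (_ : CStarAlgebra E) (f : D →⋆ₐ[ℝ] E), Function.Injective f := by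
  cases hD with
  | real =>
    refine ⟨inferInstance, inferInstance, fun x ↦ by simp [sq], ℂ, inferInstance,
      { Algebra.ofId ℝ ℂ with map_star' := fun x ↦ by simp },
      Complex.ofReal_injective⟩
  | complex =>
    refine ⟨inferInstance, inferInstance, fun x ↦ ?_, ℂ, inferInstance, StarAlgHom.id ℝ ℂ,
      Function.injective_id⟩
    rw [Complex.star_def, mul_comm, Complex.mul_conj, Complex.normSq_eq_norm_sq]
    rfl
  | quaternion =>
    refine ⟨inferInstance, ⟨fun r x ↦ by simp⟩, fun x ↦ ?_, CStarMatrix (Fin 2) (Fin 2) ℂ,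
      inferInstance, Quaternion.toCStarMatrix, Quaternion.toCStarMatrix_injective⟩
    rw [Quaternion.star_mul_self, Quaternion.normSq_eq_norm_mul_self, sq]
    rfl

end JMean

/-! ### Dictionary between the J-structures and the C⋆-algebra -/

namespace JMean

section

open Matrix

variable {D : Type} [NormedDivisionRing D] {p q : ℕ}

lemma J_mul_J : J D p q * J D p q = 1 := by
  simp [J, Matrix.fromBlocks_multiply]

lemma J_mul_J_mul (X : Mat D p q) : J D p q * (J D p q * X) = X := by
  rw [← mul_assoc, J_mul_J, one_mul]

lemma sum_norm_sq_pos {u : Fin p ⊕ Fin q → D} (hu : u ≠ 0) : 0 < ∑ i, ‖u i‖ ^ 2 := by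
  obtain ⟨i, hi⟩ := Function.ne_iff.1 hu
  exact Finset.sum_pos' (fun _ _ ↦ by positivity)
    ⟨i, Finset.mem_univ _, by have := norm_pos_iff.2 hi; positivity⟩

/-- Determinants are avoided, as D may be noncommutative: if r - X is not invertible, left
multiplication by it kills some nonzero matrix, and a nonzero column of that matrix is an
eigenvector. -/
lemma exists_mulVec_eq_smul [NormedAlgebra ℝ D] [FiniteDimensional ℝ D] {X : Mat D p q} {r : ℝ}
    (hr : r ∈ spectrum ℝ X) : ∃ u : Fin p ⊕ Fin q → D, u ≠ 0 ∧ X *ᵥ u = r • u := by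
  set Y := algebraMap ℝ (Mat D p q) r - X with hY
  have hninj : ¬ Function.Injective (LinearMap.mulLeft ℝ Y) := by
    intro hinj
    obtain ⟨Z, hZ⟩ := (LinearMap.injective_iff_surjective.1 hinj) 1
    refine hr (isUnit_iff_exists.2 ⟨Z, hZ, hinj ?_⟩)
    simp only [LinearMap.mulLeft_apply, mul_one] at hZ ⊢
    rw [← mul_assoc, hZ, one_mul]
  rw [injective_iff_map_eq_zero] at hninj
  push Not at hninj
  obtain ⟨M, hM, hM0⟩ := hninj
  obtain ⟨j, hj⟩ : ∃ j, (fun i ↦ M i j) ≠ 0 := by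
    by_contra! h
    exact hM0 (by ext i j; exact congrFun (h j) i)
  refine ⟨_, hj, ?_⟩
  have h1 : (algebraMap ℝ (Mat D p q) r) * M = X * M := by
    rw [LinearMap.mulLeft_apply, hY, sub_mul] at hM
    exact sub_eq_zero.1 hM
  ext i
  have h2 := congrFun (congrFun h1 i) j
  rw [← Algebra.smul_def] at h2
  exact h2.symm

lemma star_J [StarRing D] : star (J D p q) = J D p q := by
  simp [J, Matrix.star_eq_conjTranspose, Matrix.fromBlocks_conjTranspose]

lemma mem_hermJ_iff [StarRing D] {X : Mat D p q} : X ∈ hermJ D p q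
    ↔ star (J D p q * X) = J D p q * X := by
  change sharp X = X ↔ _
  rw [sharp, star_mul, star_J, Matrix.star_eq_conjTranspose]
  constructor
  · intro h
    nth_rw 2 [← h]
    rw [mul_assoc, J_mul_J_mul]
  · intro h
    rw [mul_assoc, h, J_mul_J_mul]

lemma star_mulVec_dotProduct_of_eq_mul_self [StarRing D] {X B : Mat D p q}
    (hB : star B = B) (hX : B * B = X)
    (u : Fin p ⊕ Fin q → D) : star (X *ᵥ u) ⬝ᵥ u = star (B *ᵥ u) ⬝ᵥ (B *ᵥ u) := by
  rw [← hX, ← mulVec_mulVec, star_mulVec B (B *ᵥ u), ← Matrix.star_eq_conjTranspose, hB,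
    dotProduct_mulVec]

end

section

open Matrix

variable {D : Type} [NormedDivisionRing D] [NormedAlgebra ℝ D] [StarRing D] {p q : ℕ}

lemma star_dotProduct_self (hst : ∀ x : D, star x * x = algebraMap ℝ D (‖x‖ ^ 2))
    (u : Fin p ⊕ Fin q → D) : star u ⬝ᵥ u = algebraMap ℝ D (∑ i, ‖u i‖ ^ 2) := by
  simp only [dotProduct, Pi.star_apply, hst, map_sum]

variable {A : Type*} [CStarAlgebra A] {φ : Mat D p q →⋆ₐ[ℝ] A}

lemma map_J_mul_jmul (X Y : Mat D p q) :
    φ (J D p q * jmul X Y) = φ (J D p q * X) * φ (J D p q * Y) := by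
  rw [jmul, ← map_mul]
  simp only [mul_assoc]

lemma map_J_mul_convexCombo (s : ℝ) (X Y : Mat D p q) :
    φ (J D p q * ((1 - s) • X + s • Y)) =
      (1 - s) • φ (J D p q * X) + s • φ (J D p q * Y) := by
  rw [mul_add, mul_smul_comm, mul_smul_comm, map_add, map_smul, map_smul]

/-- Both defining equations of K_J give a left inverse of g, so g^♯ = g⋆; hence g commutes with J.
-/
lemma map_J_mul_conj {g : Mat D p q} (hg : g ∈ compactK D p q) (X : Mat D p q) :
    φ (J D p q * (g * X * sharp g)) = φ g * φ (J D p q * X) * star (φ g) := by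
  obtain ⟨⟨hu, h1⟩, -, h2⟩ := hg
  have h3 : sharp g = star g := hu.mul_right_cancel (h1.trans h2.symm)
  have h4 : J D p q * star g = star g * J D p q := by
    rw [sharp, ← Matrix.star_eq_conjTranspose] at h3
    nth_rw 2 [← h3]
    rw [mul_assoc, J_mul_J, mul_one]
  have h5 : J D p q * g = g * J D p q := by
    simpa only [star_mul, star_star, star_J] using (congrArg star h4).symm
  rw [h3, ← map_star, ← map_mul, ← map_mul]
  congr 1
  rw [← mul_assoc, ← mul_assoc, h5]
  simp only [mul_assoc]

lemma injective_map_J_mul (hφ : Function.Injective φ) :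
    Function.Injective fun X : Mat D p q ↦ φ (J D p q * X) := fun X Y h ↦ by
  rw [← J_mul_J_mul X, hφ h, J_mul_J_mul]

variable [FiniteDimensional ℝ D]

lemma map_matrix_exp (φ : Mat D p q →⋆ₐ[ℝ] A) (X : Mat D p q) :
    φ (NormedSpace.exp X) = NormedSpace.exp (φ X) := by
  have := FiniteDimensional.complete ℝ D
  have hc : Continuous φ := LinearMap.continuous_of_finiteDimensional φ.toAlgHom.toLinearMap
  let _ : NormedRing (Mat D p q) := Matrix.linftyOpNormedRing
  let _ : NormedAlgebra ℝ (Mat D p q) := Matrix.linftyOpNormedAlgebra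
  let +nondep : NormedAlgebra ℚ (Mat D p q) := .restrictScalars ℚ ℝ _
  let +nondep : Algebra ℚ A := .restrictScalars ℚ ℝ A
  exact NormedSpace.map_exp φ hc X

lemma map_J_mul_expJ (X : Mat D p q) :
    φ (J D p q * expJ X) = NormedSpace.exp (φ (J D p q * X)) := by
  rw [expJ, J_mul_J_mul, map_matrix_exp]

variable [PartialOrder A] [StarOrderedRing A]

lemma exists_sqrt (hφ : Function.Injective φ) {X : Mat D p q} (hX : 0 ≤ φ X) :
    ∃ B, star B = B ∧ B * B = X := by
  obtain ⟨B, hB⟩ := φ.exists_map_eq_cfc (IsSelfAdjoint.of_nonneg hX) (fun x ↦ x ^ (1 / 2 : ℝ))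
  refine ⟨B, hφ ?_, hφ ?_⟩
  · rw [map_star, hB]
    exact IsSelfAdjoint.cfc.star_eq
  · rw [map_mul, hB, ← CFC.rpow_eq_cfc_real hX, ← CFC.sqrt_eq_rpow]
    exact CFC.sqrt_mul_sqrt_self _ hX

lemma isPosSemidef_of_nonneg (hst : ∀ x : D, star x * x = algebraMap ℝ D (‖x‖ ^ 2))
    (hφ : Function.Injective φ) {X : Mat D p q} (hX : 0 ≤ φ X) : IsPosSemidef X := by
  obtain ⟨B, hB, hBX⟩ := exists_sqrt hφ hX
  refine ⟨?_, fun u ↦ ⟨∑ i, ‖(B *ᵥ u) i‖ ^ 2, by positivity, ?_⟩⟩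
  · rw [Matrix.IsHermitian, ← Matrix.star_eq_conjTranspose, ← hBX, star_mul, hB]
  · rw [star_mulVec_dotProduct_of_eq_mul_self hB hBX, star_dotProduct_self hst]

lemma isPositive_of_isStrictlyPositive (hst : ∀ x : D, star x * x = algebraMap ℝ D (‖x‖ ^ 2))
    (hφ : Function.Injective φ) {X : Mat D p q} (hX : IsStrictlyPositive (φ X)) :
    IsPositive X := by
  obtain ⟨B, hB, hBX⟩ := exists_sqrt hφ hX.nonneg
  obtain ⟨C, hC⟩ := φ.exists_map_eq_cfc hX.isSelfAdjoint (fun x ↦ x ^ (-1 : ℝ))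
  -- Invertibility of X = B² makes B injective on vectors, which gives strict positivity of ‖Bu‖².
  have hCX : C * X = 1 := hφ (by
    rw [map_mul, map_one, hC, ← CFC.rpow_eq_cfc_real hX.nonneg]
    simpa [CFC.rpow_one (φ X) hX.nonneg] using CFC.rpow_neg_mul_rpow 1 hX)
  refine fun u hu ↦ ⟨∑ i, ‖(B *ᵥ u) i‖ ^ 2, sum_norm_sq_pos fun h ↦ hu ?_, ?_⟩
  · rw [← one_mulVec u, ← hCX, ← hBX, ← mul_assoc, ← mulVec_mulVec, h, mulVec_zero]
  · rw [star_mulVec_dotProduct_of_eq_mul_self hB hBX, star_dotProduct_self hst]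

lemma map_J_mul_powJ (hφ : Function.Injective φ) {X : Mat D p q}
    (hX : IsStrictlyPositive (φ (J D p q * X))) (t : ℝ) :
    φ (J D p q * powJ X t) = φ (J D p q * X) ^ t := by
  -- `Function.invFunOn` is meaningful only on the image of `expJ`, so a J-Hermitian logarithm is
  -- exhibited first.
  have hmem : ∃ L ∈ hermJ D p q, expJ L = X := by
    obtain ⟨L, hL⟩ := φ.exists_map_eq_cfc hX.isSelfAdjoint Real.log
    refine ⟨J D p q * L, mem_hermJ_iff.2 ?_, ?_⟩
    · rw [J_mul_J_mul]
      refine hφ ?_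
      rw [map_star, hL]
      exact IsSelfAdjoint.cfc.star_eq
    · rw [← J_mul_J_mul X, ← J_mul_J_mul (expJ (J D p q * L))]
      congr 1
      refine hφ ?_
      rw [map_J_mul_expJ, J_mul_J_mul, hL]
      exact CFC.exp_log _ hX
  have h1 : logJ X ∈ hermJ D p q := Function.invFunOn_mem hmem
  have h2 : expJ (logJ X) = X := Function.invFunOn_eq hmem
  have h3 : φ (J D p q * logJ X) = CFC.log (φ (J D p q * X)) := by
    nth_rw 2 [← h2]
    have h4 : IsSelfAdjoint (φ (J D p q * logJ X)) := by
      rw [isSelfAdjoint_iff, ← map_star, mem_hermJ_iff.1 h1]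
    rw [map_J_mul_expJ, CFC.log_exp _ h4]
  rw [powJ, map_J_mul_expJ, mul_smul_comm, map_smul, h3, CFC.exp_smul_log hX]

lemma map_J_mul_meanJ (hφ : Function.Injective φ) {X Y : Mat D p q}
    (hX : IsStrictlyPositive (φ (J D p q * X))) (hY : IsStrictlyPositive (φ (J D p q * Y)))
    (t : ℝ) : φ (J D p q * meanJ t X Y) =
      CFC.geomMean t (φ (J D p q * X)) (φ (J D p q * Y)) := by
  have h : φ (J D p q * jmul (jmul (powJ X (-(1 / 2))) Y) (powJ X (-(1 / 2)))) =
      φ (J D p q * X) ^ (-(1 / 2) : ℝ) * φ (J D p q * Y) * φ (J D p q * X) ^ (-(1 / 2) : ℝ) := by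
    rw [map_J_mul_jmul, map_J_mul_jmul, map_J_mul_powJ hφ hX]
  rw [meanJ, map_J_mul_jmul, map_J_mul_jmul, map_J_mul_powJ hφ hX, map_J_mul_powJ hφ, h,
    CFC.geomMean]
  rw [h]
  exact hX.conj_rpow hY _

variable [StarModule ℝ D]

/-- A real spectral value r of φ X is an eigenvalue of X; on an eigenvector u the form equals r‖u‖²,
so r > 0. -/
lemma IsPositive.isStrictlyPositive_map (hst : ∀ x : D, star x * x = algebraMap ℝ D (‖x‖ ^ 2))
    {X : Mat D p q} (hX : IsPositive X) (hs : star X = X) : IsStrictlyPositive (φ X) := by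
  rw [CStarAlgebra.isStrictlyPositive_iff_isSelfAdjoint_and_spectrum_pos]
  refine ⟨by rw [isSelfAdjoint_iff, ← map_star, hs], fun r hr ↦ ?_⟩
  obtain ⟨u, hu, hXu⟩ := exists_mulVec_eq_smul (AlgHom.spectrum_apply_subset φ X hr)
  obtain ⟨s, hs, h⟩ := hX u hu
  rw [hXu, star_smul, smul_dotProduct, star_dotProduct_self hst, star_trivial,
    Algebra.smul_def, ← map_mul] at h
  rw [(algebraMap ℝ D).injective h.symm] at hs
  exact pos_of_mul_pos_left hs (sum_norm_sq_pos hu).le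

lemma mem_posJ_iff (hst : ∀ x : D, star x * x = algebraMap ℝ D (‖x‖ ^ 2))
    (hφ : Function.Injective φ) {X : Mat D p q} :
    X ∈ posJ D p q ↔ IsStrictlyPositive (φ (J D p q * X)) := by
  constructor
  · exact fun h ↦ h.2.isStrictlyPositive_map hst (mem_hermJ_iff.1 h.1)
  · refine fun h ↦ ⟨mem_hermJ_iff.2 (hφ ?_), isPositive_of_isStrictlyPositive hst hφ h⟩
    rw [map_star, h.isSelfAdjoint.star_eq]

lemma LeJ.of_le (hst : ∀ x : D, star x * x = algebraMap ℝ D (‖x‖ ^ 2))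
    (hφ : Function.Injective φ) {X Y : Mat D p q} (hX : IsStrictlyPositive (φ (J D p q * X)))
    (hY : IsStrictlyPositive (φ (J D p q * Y)))
    (h : φ (J D p q * X) ≤ φ (J D p q * Y)) : LeJ X Y :=
  ⟨(mem_posJ_iff hst hφ).2 hX, (mem_posJ_iff hst hφ).2 hY,
    isPosSemidef_of_nonneg hst hφ (by rwa [map_sub, sub_nonneg])⟩

end

lemma exists_matrix_embedding {D : Type} [NormedDivisionRing D] [NormedAlgebra ℝ D] [StarRing D]
    (p q : ℕ)
    (h : ∃ (E : Type) (_ : CStarAlgebra E) (f : D →⋆ₐ[ℝ] E), Function.Injective f) :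
    ∃ (F : Type) (_ : CStarAlgebra F) (_ : PartialOrder F) (_ : StarOrderedRing F)
      (φ : Mat D p q →⋆ₐ[ℝ] F), Function.Injective φ := by
  obtain ⟨E, _, f, hf⟩ := h
  let _ : PartialOrder E := CStarAlgebra.spectralOrder E
  have : StarOrderedRing E := CStarAlgebra.spectralOrderedRing E
  exact ⟨CStarMatrix (Fin p ⊕ Fin q) (Fin p ⊕ Fin q) E, inferInstance, inferInstance,
    inferInstance, CStarMatrix.mapStarAlgHom f, CStarMatrix.mapStarAlgHom_injective hf⟩

end JMean

/-! ### Transfer of the four claims -/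

theorem mainTheorem6 (D : Type) [NormedDivisionRing D] [NormedAlgebra ℝ D] [StarRing D]
    (hD : JMean.IsRealComplexOrQuaternion D) (p q : ℕ) :
    (∀ g ∈ JMean.compactK D p q, ∀ t ∈ Set.Icc (0 : ℝ) 1,
      ∀ A ∈ JMean.posJ D p q, ∀ B ∈ JMean.posJ D p q,
        JMean.meanJ t (g * A * JMean.sharp g) (g * B * JMean.sharp g) =
          g * JMean.meanJ t A B * JMean.sharp g) ∧
    (∀ A ∈ JMean.posJ D p q, ∀ B ∈ JMean.posJ D p q,
      ∀ C ∈ JMean.posJ D p q, ∀ E ∈ JMean.posJ D p q,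
      ∀ t ∈ Set.Icc (0 : ℝ) 1, ∀ s ∈ Set.Icc (0 : ℝ) 1,
        JMean.LeJ ((1 - s) • JMean.meanJ t A C + s • JMean.meanJ t B E)
          (JMean.meanJ t ((1 - s) • A + s • B) ((1 - s) • C + s • E))) ∧
    (∀ A ∈ JMean.posJ D p q, ∀ B ∈ JMean.posJ D p q,
      ∀ t ∈ Set.Icc (0 : ℝ) 1, ∀ s ∈ Set.Icc (0 : ℝ) 1, ∀ u ∈ Set.Icc (0 : ℝ) 1,
        JMean.meanJ u (JMean.meanJ t A B) (JMean.meanJ s A B) =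
          JMean.meanJ ((1 - u) * t + u * s) A B) ∧
    (∀ A ∈ JMean.posJ D p q, ∀ B ∈ JMean.posJ D p q, ∀ t ∈ Set.Icc (0 : ℝ) 1,
        JMean.LeJ (JMean.harmonicJ t A B) (JMean.meanJ t A B) ∧
        JMean.LeJ (JMean.meanJ t A B) ((1 - t) • A + t • B)) := by
  open JMean in
  obtain ⟨hfin, hstm, hst, h⟩ := hD.exists_embedding
  obtain ⟨F, _, _, _, φ, hφ⟩ := exists_matrix_embedding p q h
  have pos {X : Mat D p q} (hX : X ∈ posJ D p q) : IsStrictlyPositive (φ (J D p q * X)) :=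
    (mem_posJ_iff hst hφ).1 hX
  have posMean {X Y : Mat D p q} (hX : X ∈ posJ D p q) (hY : Y ∈ posJ D p q) (t : ℝ) :
      IsStrictlyPositive (φ (J D p q * meanJ t X Y)) := by
    rw [map_J_mul_meanJ hφ (pos hX) (pos hY)]
    exact (pos hX).geomMean (pos hY) t
  have posCombo {X Y : Mat D p q} (hX : IsStrictlyPositive (φ (J D p q * X)))
      (hY : IsStrictlyPositive (φ (J D p q * Y))) {s : ℝ} (hs : s ∈ Set.Icc (0 : ℝ) 1) :
      IsStrictlyPositive (φ (J D p q * ((1 - s) • X + s • Y))) := by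
    rw [map_J_mul_convexCombo]
    exact hX.convexCombo hY hs
  refine ⟨fun g hg t _ A hA B hB ↦ injective_map_J_mul hφ ?_,
    fun A hA B hB C hC E hE t ht s hs ↦ ?_,
    fun A hA B hB t _ s _ u _ ↦ injective_map_J_mul hφ ?_, fun A hA B hB t ht ↦ ⟨?_, ?_⟩⟩
  · have hu : IsUnit (φ g) := hg.1.1.map φ
    beta_reduce
    rw [map_J_mul_conj hg, map_J_mul_meanJ hφ, map_J_mul_meanJ hφ (pos hA) (pos hB),
      map_J_mul_conj hg, map_J_mul_conj hg, CFC.geomMean_conj (pos hA) (pos hB) hu]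
    · rw [map_J_mul_conj hg]
      exact (pos hA).conj hu
    · rw [map_J_mul_conj hg]
      exact (pos hB).conj hu
  · have h1 := posCombo (pos hA) (pos hB) hs
    have h2 := posCombo (pos hC) (pos hE) hs
    have h3 : φ (J D p q * meanJ t ((1 - s) • A + s • B) ((1 - s) • C + s • E)) = _ :=
      map_J_mul_meanJ hφ h1 h2 t
    refine LeJ.of_le hst hφ (posCombo (posMean hA hC t) (posMean hB hE t) hs) ?_ ?_
    · rw [h3]
      exact h1.geomMean h2 t
    · rw [h3, map_J_mul_convexCombo, map_J_mul_convexCombo, map_J_mul_convexCombo,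
        map_J_mul_meanJ hφ (pos hA) (pos hC), map_J_mul_meanJ hφ (pos hB) (pos hE)]
      exact CFC.geomMean_jointly_concave (pos hA) (pos hB) (pos hC) (pos hE) ht hs
  · beta_reduce
    rw [map_J_mul_meanJ hφ (posMean hA hB t) (posMean hA hB s), map_J_mul_meanJ hφ (pos hA) (pos hB),
      map_J_mul_meanJ hφ (pos hA) (pos hB), map_J_mul_meanJ hφ (pos hA) (pos hB),
      CFC.geomMean_geomMean (pos hA) (pos hB)]
  · have e1 := map_J_mul_powJ hφ (pos hA) (-1)
    have e2 := map_J_mul_powJ hφ (pos hB) (-1)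
    have h1 : IsStrictlyPositive (φ (J D p q * powJ A (-1))) := e1 ▸ (pos hA).rpow _ _
    have h2 : IsStrictlyPositive (φ (J D p q * powJ B (-1))) := e2 ▸ (pos hB).rpow _ _
    have h3 := posCombo h1 h2 ht
    have h4 : φ (J D p q * harmonicJ t A B) = _ := map_J_mul_powJ hφ h3 (-1)
    refine LeJ.of_le hst hφ (h4 ▸ h3.rpow _ _) (posMean hA hB t) ?_
    rw [h4, map_J_mul_convexCombo, e1, e2, map_J_mul_meanJ hφ (pos hA) (pos hB)]
    exact CFC.harm_le_geomMean (pos hA) (pos hB) ht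
  · refine LeJ.of_le hst hφ (posMean hA hB t) (posCombo (pos hA) (pos hB) ht) ?_
    rw [map_J_mul_convexCombo, map_J_mul_meanJ hφ (pos hA) (pos hB)]
    exact CFC.geomMean_le_arith (pos hA) (pos hB) ht
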